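/- Let $a\ge 0$, $b>0$, $r>0$, $k=1/\sqrt{a^2+b^2}$, $\kappa=a/(a^2+b^2)$, and consider the arclength parameterized helix $H(s)=(a\cos ks,\,a\sin ks,\,bks)$, $s\in\mathbb R$, with the normal vectors $N(s)=(-\cos ks,-\sin ks,0)$ and $B(s)=(bk\sin ks,-bk\cos ks,ak)$, so that the normal coordinate map $(s,u_1,u_2)\mapsto \nu(s,u)=H(s)+u_1N(s)+u_2B(s)$ has Jacobian determinant $1-\kappa u_1$. Let $\mathcal C_r=\{x\in\mathbb R^3: x_1^2+x_2^2\le r^2\}$ be the infinite cylinder, with the uniform measure (Lebesgue measure restricted to $\mathcal C_r$), and for $s\in\mathbb R$ let $\mathcal E_s=\{u\in\mathbb R^2:\nu(s,u)\in\mathcal C_r\}$ be its normal cross-section at $H(s)$. For a curve $\Gamma:\mathbb R\to\mathbb R^3$ let $\lambda_\Gamma(x)$ be the largest parameter $s$ at which $\|x-\Gamma(s)\|$ is minimal; $x$ is an ambiguity point of $\Gamma$ if it has several closest points on $\Gamma$. A smooth, injective, proper, arclength parameterized curve $\Gamma$ is a principal curve of a measure $\mu$ on $\mathbb R^3$ if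 it is self-consistent, $\mathbb E[X\mid\lambda_\Gamma(X)=s]=\Gamma(s)$ for $X\sim\mu$; that is, $\lambda_\Gamma$ is Borel measurable and, for every bounded Borel set $I\subset\mathbb R$, both integrands below are $\mu$-integrable over $\lambda_\Gamma^{-1}(I)$ and $$\int_{\lambda_\Gamma^{-1}(I)}x\,d\mu(x)=\int_{\lambda_\Gamma^{-1}(I)}\Gamma(\lambda_\Gamma(x))\,d\mu(x).$$ Then the following hold. 1. For every $s$ one has $\mathcal E_s=\{u:(a-u_1)^2+(bku_2)^2\le r^2\}$. The functions $1-\kappa u_1$ and $\nu(s,u)(1-\kappa u_1)$ are integrable over $\mathcal E_s$, the number $A_s=\int_{\mathcal E_s}(1-\kappa u_1)\,du$ is positive, and the weighted mean of the cross-section is $$\bar H(s):=A_s^{-1}\int_{\mathcal E_s}\nu(s,u)\,(1-\kappa u_1)\,du=\Big(\tfrac{ar^2}{4b^2}\cos ks,\ \tfrac{ar^2}{4b^2}\sin ks,\ bks\Big);$$ in particular $\bar H(0)=\big(\tfrac{ar^2}{4b^2},0,0\big)$. 2. If the Jacobian constraint $\kappa u_1\le1$ holds for all $s$ and all $u\in\mathcal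 E_s$, then $\mathcal C_r$ contains no ambiguity point of $H$, and for every $s$ the cross-section $\mathcal E_s$ is exactly the set of those $u$ for which $\nu(s,u)$ is a point of $\mathcal C_r$ that is not an ambiguity point and has $\lambda_H(\nu(s,u))=s$. 3. If $a>0$, then $\bar H(s)=H(s)$ for all $s$ together with the Jacobian constraint holds if and only if $b=r/2$ and $a\le r/4$. 4. If $b=r/2$ and $0\le a\le r/4$, then the Jacobian constraint holds; for every $s$ the weighted mean, with the weight $1-\kappa u_1$, of the part of $\mathcal C_r$ that projects to $H(s)$ equals $H(s)$; and $H$ is a principal curve of the uniform measure on $\mathcal C_r$. -/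

import Mathlib

open MeasureTheory Filter
open scoped ContDiff

namespace PrincipalHelix

noncomputable section

/-- Euclidean three-space. -/
abbrev E3 : Type := EuclideanSpace ℝ (Fin 3)

/-! ### Principal curves parameterized over the whole real line -/

/-- The parameters of the points of the curve `Γ` that are closest to `x`. -/
def nearestParams (Γ : ℝ → E3) (x : E3) : Set ℝ :=
  {s | ‖x - Γ s‖ = ⨅ t : ℝ, ‖x - Γ t‖}

/-- The projection index `λ_Γ`: the largest parameter of a closest point. -/
def projIndex (Γ : ℝ → E3) (x : E3) : ℝ := sSup (nearestParams Γ x)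

/-- The ambiguity points of `Γ`: the points with several closest points on `Γ`. -/
def ambiguityPoints (Γ : ℝ → E3) : Set E3 :=
  {x | ∃ s ∈ nearestParams Γ x, ∃ t ∈ nearestParams Γ x, Γ s ≠ Γ t}

/-- `φ` is a version of the conditional expectation `y ↦ E[X | Y = y]` with respect to `μ`.
As `μ` may be infinite (and `X` not globally integrable), the defining identity is required on
the events `Y ∈ I` for bounded Borel sets `I`; for a finite measure and an integrable `X` this is
the usual notion. -/
structure IsCondExpGiven {Ω : Type*} [MeasurableSpace Ω] (μ : Measure Ω)
    (X : Ω → E3) (Y : Ω → ℝ) (φ : ℝ → E3) : Prop where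
  measurable_index : Measurable Y
  measurable_version : Measurable φ
  integrableOn_left : ∀ I : Set ℝ, MeasurableSet I → Bornology.IsBounded I →
    IntegrableOn X (Y ⁻¹' I) μ
  integrableOn_right : ∀ I : Set ℝ, MeasurableSet I → Bornology.IsBounded I →
    IntegrableOn (fun w => φ (Y w)) (Y ⁻¹' I) μ
  setIntegral_eq : ∀ I : Set ℝ, MeasurableSet I → Bornology.IsBounded I →
    ∫ w in Y ⁻¹' I, X w ∂μ = ∫ w in Y ⁻¹' I, φ (Y w) ∂μ

/-- Self-consistency `E[X | λ_Γ(X) = s] = Γ(s)` for `X` distributed according to `μ`. -/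
def IsSelfConsistent (μ : Measure E3) (Γ : ℝ → E3) : Prop :=
  IsCondExpGiven μ (fun x => x) (projIndex Γ) Γ

/-- `Γ` is a principal curve of `μ`: a smooth, arclength parameterized, non-self-intersecting,
self-consistent curve. Properness replaces the compactness of a curve of finite length; it makes
each point have a nonempty compact set of nearest parameters. -/
structure IsPrincipalCurve (μ : Measure E3) (Γ : ℝ → E3) : Prop where
  smooth : ContDiff ℝ ∞ Γ
  unit_speed : ∀ s, ‖deriv Γ s‖ = 1
  injective : Function.Injective Γ
  proper : Tendsto Γ (cocompact ℝ) (cocompact E3)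
  selfConsistent : IsSelfConsistent μ Γ

/-! ### The cylinder and the helix -/

/-- The solid infinite cylinder of radius `r`. -/
def solidCylinder (r : ℝ) : Set E3 := {x | x 0 ^ 2 + x 1 ^ 2 ≤ r ^ 2}

/-- The uniform measure of the cylinder. -/
def cylinderMeasure (r : ℝ) : Measure E3 := volume.restrict (solidCylinder r)

/-- `k = 1 / √(a² + b²)`. -/
def freq (a b : ℝ) : ℝ := 1 / √(a ^ 2 + b ^ 2)

/-- The helix `H`. -/
def helix (a b s : ℝ) : E3 :=
  !₂[a * Real.cos (freq a b * s), a * Real.sin (freq a b * s), b * freq a b * s]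

/-- The principal normal `N` of the Frenet frame of the helix. -/
def helixN (a b s : ℝ) : E3 :=
  !₂[-Real.cos (freq a b * s), -Real.sin (freq a b * s), 0]

/-- The binormal `B` of the Frenet frame of the helix. -/
def helixB (a b s : ℝ) : E3 :=
  !₂[b * freq a b * Real.sin (freq a b * s), -(b * freq a b * Real.cos (freq a b * s)),
    a * freq a b]

/-- The curvature `κ` of the helix. -/
def curvature (a b : ℝ) : ℝ := a / (a ^ 2 + b ^ 2)

/-- The normal coordinate map `ν(s, u) = H(s) + u₁ N(s) + u₂ B(s)`. -/
def normalMap (a b s : ℝ) (u : ℝ × ℝ) : E3 :=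
  helix a b s + u.1 • helixN a b s + u.2 • helixB a b s

/-- The Jacobian determinant `1 - κ u₁` of the normal coordinate map. -/
def jacobian (a b : ℝ) (u : ℝ × ℝ) : ℝ := 1 - curvature a b * u.1

/-- The cross-section of the cylinder with the normal plane of the helix at `H(s)`, in normal
coordinates. -/
def crossSection (a b r s : ℝ) : Set (ℝ × ℝ) := {u | normalMap a b s u ∈ solidCylinder r}

/-- The part of the cylinder that projects to `H(s)`, in normal coordinates. -/
def fibre (a b r s : ℝ) : Set (ℝ × ℝ) :=
  {u | normalMap a b s u ∈ solidCylinder r ∧ projIndex (helix a b) (normalMap a b s u) = s ∧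
    normalMap a b s u ∉ ambiguityPoints (helix a b)}

/-- The normalizing constant `A = ∫_R (1 - κ u₁) du`. -/
def weightedArea (a b : ℝ) (R : Set (ℝ × ℝ)) : ℝ := ∫ u in R, jacobian a b u

/-- The weighted mean `A⁻¹ ∫_R (H(s) + u₁ N(s) + u₂ B(s)) (1 - κ u₁) du`. -/
def weightedMean (a b s : ℝ) (R : Set (ℝ × ℝ)) : E3 :=
  (weightedArea a b R)⁻¹ • ∫ u in R, jacobian a b u • normalMap a b s u

/-- The Jacobian determinant is nonnegative on all normal cross-sections of the cylinder. -/
def JacobianConstraint (a b r : ℝ) : Prop :=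
  ∀ s, ∀ u ∈ crossSection a b r s, 0 ≤ jacobian a b u

end

end PrincipalHelix

open PrincipalHelix

namespace PrincipalHelix

/-! ### Nearest parameters of a proper curve -/

/-! In the angle `θ = k s`, half the derivative of the squared distance from `x` to the helix is
`angularSlope`. Its own derivative `a (x₀ cos θ + x₁ sin θ) + b²` is at least `b² - a r` on the
cylinder, and `a r ≤ b²` is exactly the Jacobian constraint (`jacobianConstraint_iff`). Under it the
slope is strictly increasing (`strictMono_angularSlope`), so each point of the cylinder has one
critical parameter, which is its unique nearest one. Vanishing of the slope at `k s` means lying in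
the normal plane at `H(s)`; hence the cross-sections are the fibres of the projection.

All cross-sections are the same ellipse centred at `(a, 0)`. Reflections and the second moment
`r²/4` about the centre place the weighted mean at `u₁ = a - a r²/(4b²)`, `u₂ = 0`
(`setIntegral_jacobian_smul_normalMap`). For `a > 0` this is the origin iff `r = 2b`, and then `a r
≤ b²` reads `a ≤ r/4`.

Self-consistency follows by changing to normal coordinates, whose determinant is the weight `1 - κ
u₁`, and applying Fubini: each inner integral of `x - H(s)` vanishes
(`setIntegral_sub_helix_projIndex`). -/

theorem mem_nearestParams_iff {Γ : ℝ → E3} {x : E3} {s : ℝ} :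
    s ∈ nearestParams Γ x ↔ ∀ t, ‖x - Γ s‖ ≤ ‖x - Γ t‖ := by
  have hbdd : BddBelow (Set.range fun t => ‖x - Γ t‖) :=
    ⟨0, by rintro _ ⟨t, rfl⟩; exact norm_nonneg _⟩
  constructor
  · intro h t
    have h' : ‖x - Γ s‖ = ⨅ t : ℝ, ‖x - Γ t‖ := h
    rw [h']
    exact ciInf_le hbdd t
  · intro h
    exact le_antisymm (le_ciInf h) (ciInf_le hbdd s)

theorem isCompact_nearestParams {Γ : ℝ → E3} (hc : Continuous Γ)
    (hp : Tendsto Γ (cocompact ℝ) (cocompact E3)) (x : E3) : IsCompact (nearestParams Γ x) := by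
  have hproper : IsProperMap Γ := isProperMap_iff_tendsto_cocompact.2 ⟨hc, hp⟩
  have hK := hproper.isCompact_preimage (isCompact_closedBall x ‖x - Γ 0‖)
  refine hK.of_isClosed_subset ?_ ?_
  · exact isClosed_eq (by fun_prop) continuous_const
  · intro s hs
    rw [Set.mem_preimage, Metric.mem_closedBall, dist_comm, dist_eq_norm]
    exact mem_nearestParams_iff.1 hs 0

theorem nonempty_nearestParams {Γ : ℝ → E3} (hc : Continuous Γ)
    (hp : Tendsto Γ (cocompact ℝ) (cocompact E3)) (x : E3) : (nearestParams Γ x).Nonempty := by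
  have hproper : IsProperMap Γ := isProperMap_iff_tendsto_cocompact.2 ⟨hc, hp⟩
  obtain ⟨_, ⟨s, rfl⟩, hs⟩ := hproper.isClosedMap.isClosed_range.exists_infDist_eq_dist
    (Set.range_nonempty Γ) x
  refine ⟨s, mem_nearestParams_iff.2 fun t => ?_⟩
  rw [← dist_eq_norm, ← dist_eq_norm, ← hs]
  exact Metric.infDist_le_dist_of_mem ⟨t, rfl⟩

/-- By compactness the largest nearest parameter is attained, and by properness the distance to the
closed tail is attained too. The right-hand side equates two continuous functions of `x`, so
superlevel sets of the projection index are closed; this yields its measurability. -/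
theorem le_projIndex_iff {Γ : ℝ → E3} (hc : Continuous Γ)
    (hp : Tendsto Γ (cocompact ℝ) (cocompact E3)) (c : ℝ) (x : E3) :
    c ≤ projIndex Γ x ↔
      Metric.infDist x (Γ '' Set.Ici c) = Metric.infDist x (Set.range Γ) := by
  have hproper : IsProperMap Γ := isProperMap_iff_tendsto_cocompact.2 ⟨hc, hp⟩
  have hK := isCompact_nearestParams hc hp x
  have hne := nonempty_nearestParams hc hp x
  obtain ⟨y, ⟨s, hs, rfl⟩, hsd⟩ :=
    (hproper.isClosedMap _ (isClosed_Ici (a := c))).exists_infDist_eq_dist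
      (Set.nonempty_Ici.image Γ) x
  rw [hsd]
  constructor
  · intro h
    have hmem : projIndex Γ x ∈ nearestParams Γ x := hK.sSup_mem hne
    refine le_antisymm ?_ (Metric.infDist_le_dist_of_mem ⟨s, rfl⟩)
    rw [← hsd]
    refine (Metric.le_infDist (Set.range_nonempty Γ)).2 ?_
    rintro _ ⟨t, rfl⟩
    refine (Metric.infDist_le_dist_of_mem (Set.mem_image_of_mem Γ h)).trans ?_
    simpa only [dist_eq_norm] using mem_nearestParams_iff.1 hmem t
  · intro h
    refine le_trans hs (le_csSup hK.bddAbove (mem_nearestParams_iff.2 fun t => ?_))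
    rw [← dist_eq_norm, ← dist_eq_norm, h]
    exact Metric.infDist_le_dist_of_mem ⟨t, rfl⟩

theorem measurable_projIndex {Γ : ℝ → E3} (hc : Continuous Γ)
    (hp : Tendsto Γ (cocompact ℝ) (cocompact E3)) : Measurable (projIndex Γ) := by
  refine measurable_of_Ici fun c => ?_
  have : projIndex Γ ⁻¹' Set.Ici c =
      {x | Metric.infDist x (Γ '' Set.Ici c) = Metric.infDist x (Set.range Γ)} :=
    Set.ext fun x => le_projIndex_iff hc hp c x
  rw [this]
  exact (isClosed_eq (Metric.continuous_infDist_pt _) (Metric.continuous_infDist_pt _)).measurableSet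

/-! ### The helix -/

theorem freq_pos {a b : ℝ} (hb : 0 < b) : 0 < freq a b := by
  unfold freq; positivity

theorem freq_sq_mul {a b : ℝ} (hb : 0 < b) : freq a b ^ 2 * (a ^ 2 + b ^ 2) = 1 := by
  have h : 0 < a ^ 2 + b ^ 2 := by positivity
  unfold freq
  rw [div_pow, Real.sq_sqrt h.le]
  field_simp

theorem continuous_helix (a b : ℝ) : Continuous (helix a b) := by
  unfold helix
  refine (PiLp.continuous_toLp 2 _).comp (continuous_pi fun i => ?_)
  fin_cases i <;> simp <;> fun_prop

theorem contDiff_helix (a b : ℝ) : ContDiff ℝ ∞ (helix a b) := by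
  rw [contDiff_euclidean]
  intro i
  fin_cases i <;> simp [helix] <;> fun_prop

theorem hasDerivAt_helix (a b s : ℝ) : HasDerivAt (helix a b)
    !₂[-(a * freq a b * Real.sin (freq a b * s)), a * freq a b * Real.cos (freq a b * s),
      b * freq a b] s := by
  have h : HasDerivAt (fun s => freq a b * s) (freq a b) s := by
    simpa using (hasDerivAt_id s).const_mul (freq a b)
  rw [hasDerivAt_iff_hasFDerivAt, ← hasFDerivWithinAt_univ, hasFDerivWithinAt_euclidean]
  intro i
  rw [hasFDerivWithinAt_univ, hasFDerivAt_iff_hasDerivAt]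
  fin_cases i
  · simpa [helix, mul_comm, mul_left_comm, mul_assoc] using h.cos.const_mul a
  · simpa [helix, mul_comm, mul_left_comm, mul_assoc] using h.sin.const_mul a
  · simpa [helix] using (hasDerivAt_id s).const_mul (b * freq a b)

theorem norm_deriv_helix {a b : ℝ} (hb : 0 < b) (s : ℝ) : ‖deriv (helix a b) s‖ = 1 := by
  rw [(hasDerivAt_helix a b s).deriv, EuclideanSpace.norm_eq, Real.sqrt_eq_one]
  have h := freq_sq_mul (a := a) hb
  simp [Fin.sum_univ_three]
  linear_combination h + a ^ 2 * freq a b ^ 2 * Real.sin_sq_add_cos_sq (freq a b * s)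

theorem helix_injective {a b : ℝ} (hb : 0 < b) : Function.Injective (helix a b) := by
  intro s t h
  have h2 := congrArg (fun x : E3 => x 2) h
  simpa [helix, hb.ne', (freq_pos (a := a) hb).ne'] using h2

theorem tendsto_helix_cocompact {a b : ℝ} (hb : 0 < b) :
    Tendsto (helix a b) (cocompact ℝ) (cocompact E3) := by
  rw [← Metric.cobounded_eq_cocompact (α := E3), ← tendsto_norm_atTop_iff_cobounded]
  have hpos : 0 < b * freq a b := mul_pos hb (freq_pos hb)
  refine tendsto_atTop_mono (fun s => ?_) ((tendsto_norm_cocompact_atTop (E := ℝ)).const_mul_atTop hpos)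
  have h := PiLp.norm_apply_le (helix a b s) 2
  simpa [helix, abs_of_pos hb, abs_of_pos (freq_pos (a := a) hb)] using h

/-! ### The squared distance to the helix and its unique critical point -/

theorem norm_sub_helix_sq (a b s : ℝ) (x : E3) : ‖x - helix a b s‖ ^ 2 =
    (x 0 - a * Real.cos (freq a b * s)) ^ 2 + (x 1 - a * Real.sin (freq a b * s)) ^ 2 +
      (x 2 - b * (freq a b * s)) ^ 2 := by
  rw [EuclideanSpace.real_norm_sq_eq]
  simp [Fin.sum_univ_three, helix, mul_assoc]

/-- Half the derivative, with respect to the angle, of the squared distance to the helix. -/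
noncomputable def angularSlope (a b : ℝ) (x : E3) (θ : ℝ) : ℝ :=
  a * (x 0 * Real.sin θ - x 1 * Real.cos θ) - b * (x 2 - b * θ)

theorem hasDerivAt_sq_dist (a b : ℝ) (x : E3) (θ : ℝ) :
    HasDerivAt (fun θ => (x 0 - a * Real.cos θ) ^ 2 + (x 1 - a * Real.sin θ) ^ 2 +
      (x 2 - b * θ) ^ 2) (2 * angularSlope a b x θ) θ := by
  have h0 := (((Real.hasDerivAt_cos θ).const_mul a).const_sub (x 0)).pow 2
  have h1 := (((Real.hasDerivAt_sin θ).const_mul a).const_sub (x 1)).pow 2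
  have h2 := (((hasDerivAt_id θ).const_mul b).const_sub (x 2)).pow 2
  refine ((h0.add h1).add h2).congr_deriv ?_
  simp [angularSlope]
  ring

/-- When `a r = b²` the derivative of the slope may vanish, so a derivative bound would not give
strictness directly. Instead two values are compared through their midpoint `m` and half-gap `δ`:
strictness comes from `|sin δ| < δ`, and `|P| ≤ r` is Cauchy–Schwarz. -/
theorem strictMono_angularSlope {a b r : ℝ} (ha : 0 ≤ a) (hb : 0 < b) (hr : 0 < r)
    (h : a * r ≤ b ^ 2) {x : E3} (hx : x ∈ solidCylinder r) :
    StrictMono (angularSlope a b x) := by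
  intro θ θ' hlt
  obtain ⟨m, δ, hδ, rfl, rfl⟩ : ∃ m δ : ℝ, 0 < δ ∧ θ = m - δ ∧ θ' = m + δ :=
    ⟨(θ + θ') / 2, (θ' - θ) / 2, by linarith, by ring, by ring⟩
  set P := x 0 * Real.cos m + x 1 * Real.sin m with hP
  have hxr : x 0 ^ 2 + x 1 ^ 2 ≤ r ^ 2 := hx
  have hPr : |P| ≤ r := by
    refine abs_le_of_sq_le_sq ?_ hr.le
    nlinarith [Real.sin_sq_add_cos_sq m, sq_nonneg (x 0 * Real.sin m - x 1 * Real.cos m)]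
  have hsin : |Real.sin δ| < δ := by
    have := Real.abs_sin_lt_abs hδ.ne'
    rwa [abs_of_pos hδ] at this
  have h1 : |a * Real.sin δ * P| < b ^ 2 * δ := by
    calc |a * Real.sin δ * P| = a * |P| * |Real.sin δ| := by
          rw [abs_mul, abs_mul, abs_of_nonneg ha]; ring
      _ ≤ b ^ 2 * |Real.sin δ| :=
          mul_le_mul_of_nonneg_right ((mul_le_mul_of_nonneg_left hPr ha).trans h) (abs_nonneg _)
      _ < b ^ 2 * δ := mul_lt_mul_of_pos_left hsin (by positivity)
  have h2 : angularSlope a b x (m + δ) - angularSlope a b x (m - δ) =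
      2 * (a * Real.sin δ * P + b ^ 2 * δ) := by
    simp only [angularSlope, Real.sin_add, Real.sin_sub, Real.cos_add, Real.cos_sub, hP]
    ring
  linarith [neg_abs_le (a * Real.sin δ * P)]

theorem lt_of_deriv_strictMono {F g : ℝ → ℝ} (hF : ∀ θ, HasDerivAt F (2 * g θ) θ)
    (hg : StrictMono g) {θ₀ : ℝ} (h₀ : g θ₀ = 0) {θ : ℝ} (hne : θ ≠ θ₀) : F θ₀ < F θ := by
  have hcont : Continuous F := continuous_iff_continuousAt.2 fun θ => (hF θ).continuousAt
  rcases lt_or_gt_of_ne hne with hlt | hlt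
  · refine strictAntiOn_of_deriv_neg (convex_Iic θ₀) hcont.continuousOn ?_ hlt.le
      Set.self_mem_Iic hlt
    intro y hy
    rw [interior_Iic] at hy
    rw [(hF y).deriv]
    linarith [hg hy]
  · refine strictMonoOn_of_deriv_pos (convex_Ici θ₀) hcont.continuousOn ?_
      Set.self_mem_Ici hlt.le hlt
    intro y hy
    rw [interior_Ici] at hy
    rw [(hF y).deriv]
    linarith [hg hy]

theorem angularSlope_eq_zero_of_mem_nearestParams {a b : ℝ} (hb : 0 < b) {x : E3} {s : ℝ}
    (hs : s ∈ nearestParams (helix a b) x) : angularSlope a b x (freq a b * s) = 0 := by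
  have hk := freq_pos (a := a) hb
  have hmin : IsLocalMin (fun θ => (x 0 - a * Real.cos θ) ^ 2 + (x 1 - a * Real.sin θ) ^ 2 +
      (x 2 - b * θ) ^ 2) (freq a b * s) := by
    refine Eventually.of_forall fun θ => ?_
    have h := mem_nearestParams_iff.1 hs (θ / freq a b)
    have h2 := pow_le_pow_left₀ (norm_nonneg _) h 2
    rwa [norm_sub_helix_sq, norm_sub_helix_sq, mul_div_cancel₀ _ hk.ne'] at h2
  have := hmin.hasDerivAt_eq_zero (hasDerivAt_sq_dist a b x _)
  linarith

theorem nearestParams_eq_singleton {a b r : ℝ} (ha : 0 ≤ a) (hb : 0 < b) (hr : 0 < r)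
    (h : a * r ≤ b ^ 2) {x : E3} (hx : x ∈ solidCylinder r) {s : ℝ}
    (hs : angularSlope a b x (freq a b * s) = 0) : nearestParams (helix a b) x = {s} := by
  have hk := freq_pos (a := a) hb
  have hmono := strictMono_angularSlope ha hb hr h hx
  refine Set.eq_singleton_iff_unique_mem.2 ⟨mem_nearestParams_iff.2 fun t => ?_, fun t ht => ?_⟩
  · rcases eq_or_ne t s with rfl | hne
    · rfl
    refine le_of_sq_le_sq ?_ (norm_nonneg _)
    rw [norm_sub_helix_sq, norm_sub_helix_sq]
    exact (lt_of_deriv_strictMono (hasDerivAt_sq_dist a b x) hmono hs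
      (fun e => hne (mul_left_cancel₀ hk.ne' e))).le
  · have := angularSlope_eq_zero_of_mem_nearestParams hb ht
    exact mul_left_cancel₀ hk.ne' (hmono.injective (this.trans hs.symm))

theorem projIndex_eq_of_angularSlope {a b r : ℝ} (ha : 0 ≤ a) (hb : 0 < b) (hr : 0 < r)
    (h : a * r ≤ b ^ 2) {x : E3} (hx : x ∈ solidCylinder r) {s : ℝ}
    (hs : angularSlope a b x (freq a b * s) = 0) : projIndex (helix a b) x = s := by
  rw [projIndex, nearestParams_eq_singleton ha hb hr h hx hs, csSup_singleton]

/-! ### Normal planes, cross-sections and fibres -/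

theorem normalMap_apply_zero (a b s : ℝ) (u : ℝ × ℝ) : normalMap a b s u 0 =
    (a - u.1) * Real.cos (freq a b * s) + b * freq a b * u.2 * Real.sin (freq a b * s) := by
  simp [normalMap, helix, helixN, helixB]; ring

theorem normalMap_apply_one (a b s : ℝ) (u : ℝ × ℝ) : normalMap a b s u 1 =
    (a - u.1) * Real.sin (freq a b * s) - b * freq a b * u.2 * Real.cos (freq a b * s) := by
  simp [normalMap, helix, helixN, helixB]; ring

theorem normalMap_apply_two (a b s : ℝ) (u : ℝ × ℝ) : normalMap a b s u 2 =
    b * freq a b * s + a * freq a b * u.2 := by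
  simp [normalMap, helix, helixN, helixB]; ring

theorem angularSlope_normalMap (a b s : ℝ) (u : ℝ × ℝ) :
    angularSlope a b (normalMap a b s u) (freq a b * s) = 0 := by
  rw [angularSlope, normalMap_apply_zero, normalMap_apply_one, normalMap_apply_two]
  linear_combination a * b * freq a b * u.2 * Real.sin_sq_add_cos_sq (freq a b * s)

/-- The slope at `k s` is a nonzero multiple of the inner product of `x - H(s)` with the tangent, so
its vanishing puts `x` in the normal plane. -/
theorem exists_normalMap_eq {a b : ℝ} (hb : 0 < b) {x : E3} {s : ℝ}
    (hs : angularSlope a b x (freq a b * s) = 0) : ∃ u, normalMap a b s u = x := by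
  have hk := freq_sq_mul (a := a) hb
  have htrig := Real.sin_sq_add_cos_sq (freq a b * s)
  set k := freq a b with hkdef
  set S := Real.sin (k * s) with hS
  set C := Real.cos (k * s) with hC
  have hs' : a * (x 0 * S - x 1 * C) - b * (x 2 - b * (k * s)) = 0 := hs
  -- The witnesses are the inner products of `x - H(s)` with `N(s)` and `B(s)`.
  refine ⟨(a - (x 0 * C + x 1 * S), b * k * (x 0 * S - x 1 * C) + a * k * (x 2 - b * (k * s))), ?_⟩
  ext i
  fin_cases i
  · show normalMap a b s _ 0 = x 0
    rw [normalMap_apply_zero, ← hkdef, ← hS, ← hC]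
    linear_combination x 0 * htrig - a * k ^ 2 * S * hs' + S * (x 0 * S - x 1 * C) * hk
  · show normalMap a b s _ 1 = x 1
    rw [normalMap_apply_one, ← hkdef, ← hS, ← hC]
    linear_combination x 1 * htrig + a * k ^ 2 * C * hs' - C * (x 0 * S - x 1 * C) * hk
  · show normalMap a b s _ 2 = x 2
    rw [normalMap_apply_two, ← hkdef]
    linear_combination b * k ^ 2 * hs' + (x 2 - b * (k * s)) * hk

theorem normalMap_injective {a b : ℝ} (hb : 0 < b) (s : ℝ) :
    Function.Injective (normalMap a b s) := by
  intro u v h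
  have hk := freq_sq_mul (a := a) hb
  have htrig := Real.sin_sq_add_cos_sq (freq a b * s)
  have h0 := congrArg (fun x : E3 => x 0) h
  have h1 := congrArg (fun x : E3 => x 1) h
  have h2 := congrArg (fun x : E3 => x 2) h
  simp only [normalMap_apply_zero, normalMap_apply_one, normalMap_apply_two] at h0 h1 h2
  set k := freq a b with hkdef
  set S := Real.sin (k * s) with hS
  set C := Real.cos (k * s) with hC
  refine Prod.ext ?_ ?_
  -- The coefficients pair the vector equation with `N(s)` here and with `B(s)` below, using
  -- orthonormality.
  · linear_combination -C * h0 - S * h1 - (u.1 - v.1) * htrig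
  · linear_combination b * k * S * h0 - b * k * C * h1 + a * k * h2 - (u.2 - v.2) * hk
      - b ^ 2 * k ^ 2 * (u.2 - v.2) * htrig

/-- The cross-section as a region of the plane. -/
theorem crossSection_eq (a b r s : ℝ) :
    crossSection a b r s = {u | (a - u.1) ^ 2 + (b * freq a b * u.2) ^ 2 ≤ r ^ 2} := by
  ext u
  have htrig := Real.sin_sq_add_cos_sq (freq a b * s)
  show normalMap a b s u 0 ^ 2 + normalMap a b s u 1 ^ 2 ≤ r ^ 2 ↔ _
  rw [normalMap_apply_zero, normalMap_apply_one, Set.mem_ofPred_eq]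
  have : ((a - u.1) * Real.cos (freq a b * s) + b * freq a b * u.2 * Real.sin (freq a b * s)) ^ 2 +
      ((a - u.1) * Real.sin (freq a b * s) - b * freq a b * u.2 * Real.cos (freq a b * s)) ^ 2 =
      (a - u.1) ^ 2 + (b * freq a b * u.2) ^ 2 := by
    linear_combination ((a - u.1) ^ 2 + (b * freq a b * u.2) ^ 2) * htrig
  rw [this]

/-- The largest `u₁` on the ellipse is `a + r`, reached at `(a + r, 0)`, and `a (a + r) ≤ a² + b²`
is `a r ≤ b²`. -/
theorem jacobianConstraint_iff {a b r : ℝ} (ha : 0 ≤ a) (hb : 0 < b) (hr : 0 < r) :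
    JacobianConstraint a b r ↔ a * r ≤ b ^ 2 := by
  have hc : 0 < a ^ 2 + b ^ 2 := by positivity
  have hj : ∀ u : ℝ × ℝ, 0 ≤ jacobian a b u ↔ a * u.1 ≤ a ^ 2 + b ^ 2 := by
    intro u
    rw [jacobian, curvature, sub_nonneg, div_mul_eq_mul_div, div_le_one hc]
  constructor
  · intro h
    have := (hj _).1 (h 0 (a + r, 0) (by rw [crossSection_eq]; simp))
    dsimp only at this
    linarith
  · intro h s u hu
    rw [crossSection_eq] at hu
    have hu' : (a - u.1) ^ 2 + (b * freq a b * u.2) ^ 2 ≤ r ^ 2 := hu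
    have : |a - u.1| ≤ r := abs_le_of_sq_le_sq (by nlinarith [sq_nonneg (b * freq a b * u.2)]) hr.le
    rw [hj]
    nlinarith [(abs_le.1 this).1]

theorem disjoint_ambiguityPoints {a b r : ℝ} (ha : 0 ≤ a) (hb : 0 < b) (hr : 0 < r)
    (h : a * r ≤ b ^ 2) : Disjoint (solidCylinder r) (ambiguityPoints (helix a b)) := by
  rw [Set.disjoint_left]
  rintro x hx ⟨s, hs, t, ht, hne⟩
  have := nearestParams_eq_singleton ha hb hr h hx (angularSlope_eq_zero_of_mem_nearestParams hb hs)
  rw [this] at ht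
  exact hne (congrArg _ (Set.mem_singleton_iff.1 ht).symm)

theorem projIndex_normalMap {a b r : ℝ} (ha : 0 ≤ a) (hb : 0 < b) (hr : 0 < r)
    (h : a * r ≤ b ^ 2) {s : ℝ} {u : ℝ × ℝ} (hu : u ∈ crossSection a b r s) :
    projIndex (helix a b) (normalMap a b s u) = s :=
  projIndex_eq_of_angularSlope ha hb hr h hu (angularSlope_normalMap a b s u)

theorem fibre_eq_crossSection {a b r : ℝ} (ha : 0 ≤ a) (hb : 0 < b) (hr : 0 < r)
    (h : a * r ≤ b ^ 2) (s : ℝ) : fibre a b r s = crossSection a b r s := by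
  ext u
  exact ⟨fun hu => hu.1, fun hu => ⟨hu, projIndex_normalMap ha hb hr h hu,
    Set.disjoint_left.1 (disjoint_ambiguityPoints ha hb hr h) hu⟩⟩

/-! ### Moments of a planar ellipse -/

/-- The solid ellipse with centre `(a, 0)` and semi-axes `r` and `r / c`. -/
def solidEllipse (a c r : ℝ) : Set (ℝ × ℝ) := {u | (a - u.1) ^ 2 + (c * u.2) ^ 2 ≤ r ^ 2}

theorem isCompact_solidEllipse (a : ℝ) {c r : ℝ} (hc : 0 < c) (hr : 0 < r) :
    IsCompact (solidEllipse a c r) := by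
  refine (isCompact_Icc (a := (a - r, -(r / c))) (b := (a + r, r / c))).of_isClosed_subset ?_ ?_
  · exact isClosed_le (by fun_prop) continuous_const
  · intro u hu
    have hu' : (a - u.1) ^ 2 + (c * u.2) ^ 2 ≤ r ^ 2 := hu
    have h1 : |a - u.1| ≤ r := abs_le_of_sq_le_sq (by nlinarith [sq_nonneg (c * u.2)]) hr.le
    have h2 : |c * u.2| ≤ r := abs_le_of_sq_le_sq (by nlinarith [sq_nonneg (a - u.1)]) hr.le
    rw [abs_mul, abs_of_pos hc, mul_comm, ← le_div_iff₀ hc] at h2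
    obtain ⟨h3, h4⟩ := abs_le.1 h1
    obtain ⟨h5, h6⟩ := abs_le.1 h2
    exact ⟨⟨by dsimp only; linarith, h5⟩, ⟨by dsimp only; linarith, h6⟩⟩

theorem measurableSet_solidEllipse (a : ℝ) {c r : ℝ} (hc : 0 < c) (hr : 0 < r) :
    MeasurableSet (solidEllipse a c r) :=
  (isCompact_solidEllipse a hc hr).isClosed.measurableSet

theorem integrableOn_solidEllipse (a : ℝ) {c r : ℝ} (hc : 0 < c) (hr : 0 < r) {F : Type*}
    [NormedAddCommGroup F] {f : ℝ × ℝ → F} (hf : Continuous f) :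
    IntegrableOn f (solidEllipse a c r) :=
  hf.continuousOn.integrableOn_compact (isCompact_solidEllipse a hc hr)

theorem volume_solidEllipse_pos (a : ℝ) {c r : ℝ} (hc : 0 < c) (hr : 0 < r) :
    0 < volume.real (solidEllipse a c r) := by
  refine ENNReal.toReal_pos ?_ (isCompact_solidEllipse a hc hr).measure_lt_top.ne
  have hopen : IsOpen {u : ℝ × ℝ | (a - u.1) ^ 2 + (c * u.2) ^ 2 < r ^ 2} :=
    isOpen_lt (by fun_prop) continuous_const
  have hpos := hopen.measure_pos volume ⟨(a, 0), by simp [hr]⟩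
  exact (hpos.trans_le (measure_mono fun u hu => le_of_lt (α := ℝ) hu)).ne'

theorem setIntegral_eq_zero_of_odd {α : Type*} [MeasurableSpace α] {μ : Measure α} {T : α ≃ᵐ α}
    (hT : MeasurePreserving T μ μ) {E : Set α} (hE : T ⁻¹' E = E) {f : α → ℝ}
    (hf : ∀ x, f (T x) = -f x) : ∫ x in E, f x ∂μ = 0 := by
  have h := hT.setIntegral_preimage_emb T.measurableEmbedding f E
  simp only [hE, hf, integral_neg] at h
  linarith

/-- Reflection in the line `u₁ = a` preserves the ellipse and flips the sign of the integrand. No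
regularity of `g` is needed, since the integral equals its own negative in any case. -/
theorem setIntegral_fst_sub_eq_zero (a c r : ℝ) {g : ℝ → ℝ} :
    ∫ u in solidEllipse a c r, (u.1 - a) * g u.2 = 0 := by
  have hT : MeasurePreserving
      (MeasurableEquiv.prodCongr (MeasurableEquiv.subLeft (2 * a)) (MeasurableEquiv.refl ℝ))
      (volume : Measure (ℝ × ℝ)) volume :=
    (Measure.measurePreserving_sub_left volume (2 * a)).prod (MeasurePreserving.id volume)
  refine setIntegral_eq_zero_of_odd hT ?_ fun u => ?_
  · ext u
    change (a - (2 * a - u.1)) ^ 2 + (c * u.2) ^ 2 ≤ r ^ 2 ↔ (a - u.1) ^ 2 + (c * u.2) ^ 2 ≤ r ^ 2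
    rw [show a - (2 * a - u.1) = -(a - u.1) by ring, neg_sq]
  · change (2 * a - u.1 - a) * g u.2 = -((u.1 - a) * g u.2)
    ring

theorem setIntegral_snd_eq_zero (a c r : ℝ) {g : ℝ → ℝ} :
    ∫ u in solidEllipse a c r, g u.1 * u.2 = 0 := by
  have hT : MeasurePreserving
      (MeasurableEquiv.prodCongr (MeasurableEquiv.refl ℝ) (MeasurableEquiv.neg ℝ))
      (volume : Measure (ℝ × ℝ)) volume :=
    (MeasurePreserving.id volume).prod (Measure.measurePreserving_neg volume)
  refine setIntegral_eq_zero_of_odd hT ?_ fun u => ?_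
  · ext u
    change (a - u.1) ^ 2 + (c * -u.2) ^ 2 ≤ r ^ 2 ↔ (a - u.1) ^ 2 + (c * u.2) ^ 2 ≤ r ^ 2
    rw [mul_neg, neg_sq]
  · exact mul_neg (g u.1) u.2

/-- With `t = v - a`, the integrand is the derivative of `t (r² - t²)^(3/2)` on `|t| < r`, and this
primitive vanishes at `t = ±r`. The second moment is thus obtained without computing the area of the
ellipse. -/
theorem integral_sqrt_mul_eq_zero {r : ℝ} (a : ℝ) (hr : 0 < r) :
    ∫ v : ℝ, (r ^ 2 - 4 * (v - a) ^ 2) * √(r ^ 2 - (v - a) ^ 2) = 0 := by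
  -- `Real.sqrt` is `0` on negative numbers, so the integral over the line reduces to the interval.
  have hsupp : ∀ v ∉ Set.Ioc (a - r) (a + r),
      (r ^ 2 - 4 * (v - a) ^ 2) * √(r ^ 2 - (v - a) ^ 2) = 0 := by
    intro v hv
    rw [Real.sqrt_eq_zero_of_nonpos, mul_zero]
    rw [Set.mem_Ioc, not_and_or, not_lt, not_le] at hv
    rcases hv with hv | hv <;> nlinarith
  rw [← setIntegral_eq_integral_of_forall_compl_eq_zero hsupp,
    ← intervalIntegral.integral_of_le (by linarith)]
  rw [intervalIntegral.integral_eq_sub_of_hasDerivAt_of_le (by linarith)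
    (f := fun v => (v - a) * (r ^ 2 - (v - a) ^ 2) * √(r ^ 2 - (v - a) ^ 2))
    (by fun_prop) ?_ (by apply Continuous.intervalIntegrable; fun_prop)]
  · simp
  · intro v hv
    have hw : 0 < r ^ 2 - (v - a) ^ 2 := by nlinarith [hv.1, hv.2]
    have h1 : HasDerivAt (fun v : ℝ => v - a) 1 v := (hasDerivAt_id v).sub_const a
    have h2 : HasDerivAt (fun v : ℝ => r ^ 2 - (v - a) ^ 2) (-(2 * (v - a))) v := by
      simpa using (h1.pow 2).const_sub (r ^ 2)
    refine ((h1.mul h2).mul (h2.sqrt hw.ne')).congr_deriv ?_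
    have hs := Real.sqrt_pos.2 hw
    have hsq := Real.sq_sqrt hw.le
    simp only [Pi.mul_apply]
    field_simp
    rw [hsq]
    ring

theorem volume_slice (a v : ℝ) {c : ℝ} (r : ℝ) (hc : 0 < c) :
    volume.real {y : ℝ | (a - v) ^ 2 + (c * y) ^ 2 ≤ r ^ 2} =
      2 / c * √(r ^ 2 - (v - a) ^ 2) := by
  rcases lt_or_ge (r ^ 2 - (v - a) ^ 2) 0 with h | h
  · have : {y : ℝ | (a - v) ^ 2 + (c * y) ^ 2 ≤ r ^ 2} = ∅ := by
      refine Set.eq_empty_of_forall_notMem fun y hy => ?_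
      have hy' : (a - v) ^ 2 + (c * y) ^ 2 ≤ r ^ 2 := hy
      nlinarith [sq_nonneg (c * y)]
    rw [this, Real.sqrt_eq_zero_of_nonpos h.le]
    simp
  · have : {y : ℝ | (a - v) ^ 2 + (c * y) ^ 2 ≤ r ^ 2} =
        Set.Icc (-(√(r ^ 2 - (v - a) ^ 2) / c)) (√(r ^ 2 - (v - a) ^ 2) / c) := by
      ext y
      rw [Set.mem_Icc, ← abs_le, le_div_iff₀ hc, ← abs_of_pos hc, ← abs_mul, abs_of_pos hc,
        Real.le_sqrt (abs_nonneg _) h, sq_abs, Set.mem_ofPred_eq]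
      constructor <;> intro hy <;> nlinarith
    rw [this, Real.volume_real_Icc_of_le]
    · ring
    · have : 0 ≤ √(r ^ 2 - (v - a) ^ 2) / c := by positivity
      linarith

/-- This says that `(u₁ - a)²` has mean `r²/4` over the ellipse. Fubini over vertical slices of
length `2/c · √(r² - (v - a)²)` reduces it to `integral_sqrt_mul_eq_zero`. -/
theorem setIntegral_sq_sub (a : ℝ) {c r : ℝ} (hc : 0 < c) (hr : 0 < r) :
    ∫ u in solidEllipse a c r, (r ^ 2 - 4 * (u.1 - a) ^ 2) = 0 := by
  have hm := measurableSet_solidEllipse a hc hr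
  rw [← integral_indicator hm, Measure.volume_eq_prod, integral_prod]
  · calc _ = ∫ v : ℝ, 2 / c * ((r ^ 2 - 4 * (v - a) ^ 2) * √(r ^ 2 - (v - a) ^ 2)) := by
          refine integral_congr_ae (Eventually.of_forall fun v => ?_)
          have hE : MeasurableSet {y : ℝ | (a - v) ^ 2 + (c * y) ^ 2 ≤ r ^ 2} :=
            measurable_prodMk_left hm
          have : (fun y => (solidEllipse a c r).indicator
              (fun u : ℝ × ℝ => r ^ 2 - 4 * (u.1 - a) ^ 2) (v, y)) =
              {y : ℝ | (a - v) ^ 2 + (c * y) ^ 2 ≤ r ^ 2}.indicator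
                fun _ => r ^ 2 - 4 * (v - a) ^ 2 := by
            ext y
            rfl
          dsimp only
          rw [this, integral_indicator hE, setIntegral_const, volume_slice a v r hc, smul_eq_mul]
          ring
      _ = 0 := by rw [integral_const_mul, integral_sqrt_mul_eq_zero a hr, mul_zero]
  · rw [← Measure.volume_eq_prod, integrable_indicator_iff hm]
    exact integrableOn_solidEllipse a hc hr (by fun_prop)

theorem setIntegral_fst (a : ℝ) {c r : ℝ} (hc : 0 < c) (hr : 0 < r) :
    ∫ u in solidEllipse a c r, u.1 = a * volume.real (solidEllipse a c r) := by
  have h := setIntegral_fst_sub_eq_zero a c r (g := fun _ => 1)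
  simp only [mul_one] at h
  rw [integral_sub (integrableOn_solidEllipse a hc hr (by fun_prop))
    (integrableOn_solidEllipse a hc hr (by fun_prop)), setIntegral_const, smul_eq_mul] at h
  linarith

theorem setIntegral_fst_sq (a : ℝ) {c r : ℝ} (hc : 0 < c) (hr : 0 < r) :
    ∫ u in solidEllipse a c r, u.1 ^ 2 =
      (a ^ 2 + r ^ 2 / 4) * volume.real (solidEllipse a c r) := by
  have h := setIntegral_sq_sub a hc hr
  have hi : ∀ {f : ℝ × ℝ → ℝ}, Continuous f → IntegrableOn f (solidEllipse a c r) :=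
    fun hf => integrableOn_solidEllipse a hc hr hf
  have h1 : ∀ u : ℝ × ℝ, r ^ 2 - 4 * (u.1 - a) ^ 2 =
      -4 * u.1 ^ 2 + (8 * a * u.1 + (r ^ 2 - 4 * a ^ 2)) := fun u => by ring
  simp only [h1] at h
  rw [integral_add (hi (by fun_prop)) (hi (by fun_prop)),
    integral_add (hi (by fun_prop)) (hi (by fun_prop)), integral_const_mul, integral_const_mul,
    setIntegral_fst a hc hr, setIntegral_const, smul_eq_mul] at h
  linarith

/-! ### The weighted mean of the cross-sections -/

theorem continuous_jacobian (a b : ℝ) : Continuous (jacobian a b) := by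
  unfold jacobian; fun_prop

theorem continuous_normalMap (a b s : ℝ) : Continuous (normalMap a b s) := by
  unfold normalMap; fun_prop

theorem crossSection_eq_solidEllipse (a b r s : ℝ) :
    crossSection a b r s = solidEllipse a (b * freq a b) r :=
  crossSection_eq a b r s

theorem one_sub_curvature_mul {a b : ℝ} (hb : 0 < b) :
    1 - curvature a b * a = b ^ 2 / (a ^ 2 + b ^ 2) := by
  have : a ^ 2 + b ^ 2 ≠ 0 := by positivity
  rw [curvature]
  field_simp
  ring

theorem weightedArea_solidEllipse {a b c r : ℝ} (hb : 0 < b) (hc : 0 < c) (hr : 0 < r) :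
    weightedArea a b (solidEllipse a c r) =
      b ^ 2 / (a ^ 2 + b ^ 2) * volume.real (solidEllipse a c r) := by
  simp only [weightedArea, jacobian]
  rw [integral_sub (integrableOn_solidEllipse a hc hr (by fun_prop))
    (integrableOn_solidEllipse a hc hr (by fun_prop)), setIntegral_const, integral_const_mul,
    setIntegral_fst a hc hr, ← one_sub_curvature_mul hb, smul_eq_mul]
  ring

theorem weightedArea_crossSection_pos {a b r : ℝ} (hb : 0 < b) (hr : 0 < r) (s : ℝ) :
    0 < weightedArea a b (crossSection a b r s) := by
  have hc : 0 < b * freq a b := mul_pos hb (freq_pos hb)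
  rw [crossSection_eq_solidEllipse, weightedArea_solidEllipse hb hc hr]
  have := volume_solidEllipse_pos a hc hr
  positivity

theorem setIntegral_jacobian_mul_fst (a b : ℝ) {c r : ℝ} (hc : 0 < c) (hr : 0 < r) :
    ∫ u in solidEllipse a c r, jacobian a b u * u.1 =
      (a - curvature a b * (a ^ 2 + r ^ 2 / 4)) * volume.real (solidEllipse a c r) := by
  have h : ∀ u : ℝ × ℝ, jacobian a b u * u.1 = u.1 - curvature a b * u.1 ^ 2 := by
    intro u; rw [jacobian]; ring
  simp only [h]
  rw [integral_sub (integrableOn_solidEllipse a hc hr (by fun_prop))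
    (integrableOn_solidEllipse a hc hr (by fun_prop)), integral_const_mul,
    setIntegral_fst a hc hr, setIntegral_fst_sq a hc hr]
  ring

theorem setIntegral_jacobian_smul_normalMap {a b r : ℝ} (hb : 0 < b) (hr : 0 < r) (s : ℝ) :
    ∫ u in crossSection a b r s, jacobian a b u • normalMap a b s u =
      weightedArea a b (crossSection a b r s) •
        (helix a b s + (a - a * r ^ 2 / (4 * b ^ 2)) • helixN a b s) := by
  have hc : 0 < b * freq a b := mul_pos hb (freq_pos hb)
  have hJ := continuous_jacobian a b
  rw [crossSection_eq_solidEllipse]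
  have hsplit : ∀ u : ℝ × ℝ, jacobian a b u • normalMap a b s u =
      jacobian a b u • helix a b s + ((jacobian a b u * u.1) • helixN a b s +
        (jacobian a b u * u.2) • helixB a b s) := by
    intro u
    rw [normalMap]
    module
  simp only [hsplit]
  rw [integral_add (integrableOn_solidEllipse a hc hr (by fun_prop))
      (integrableOn_solidEllipse a hc hr (by fun_prop)),
    integral_add (integrableOn_solidEllipse a hc hr (by fun_prop))
      (integrableOn_solidEllipse a hc hr (by fun_prop)),
    integral_smul_const, integral_smul_const, integral_smul_const,
    setIntegral_jacobian_mul_fst a b hc hr]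
  have h2 : ∫ u in solidEllipse a (b * freq a b) r, jacobian a b u * u.2 = 0 :=
    setIntegral_snd_eq_zero a (b * freq a b) r (g := fun v => 1 - curvature a b * v)
  rw [h2, zero_smul, add_zero, smul_add, smul_smul]
  -- What remains is the coefficient of `N(s)`: `a - κ (a² + r²/4) = (1 - κ a)(a - a r²/(4b²))`, up
  -- to the area factor.
  congr 2
  rw [weightedArea_solidEllipse hb hc hr, curvature]
  have : a ^ 2 + b ^ 2 ≠ 0 := by positivity
  field_simp
  ring

theorem weightedMean_crossSection {a b r : ℝ} (hb : 0 < b) (hr : 0 < r) (s : ℝ) :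
    weightedMean a b s (crossSection a b r s) =
      !₂[a * r ^ 2 / (4 * b ^ 2) * Real.cos (freq a b * s),
        a * r ^ 2 / (4 * b ^ 2) * Real.sin (freq a b * s), b * freq a b * s] := by
  rw [weightedMean, setIntegral_jacobian_smul_normalMap hb hr,
    inv_smul_smul₀ (weightedArea_crossSection_pos hb hr s).ne']
  ext i
  fin_cases i <;> simp [helix, helixN] <;> ring

theorem weightedMean_crossSection_eq_helix {a b r : ℝ} (hb : 0 < b) (hr : 0 < r) (h : b = r / 2)
    (s : ℝ) : weightedMean a b s (crossSection a b r s) = helix a b s := by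
  have : a * r ^ 2 / (4 * b ^ 2) = a := by rw [h]; field_simp; norm_num
  rw [weightedMean_crossSection hb hr, this, helix]

/-! ### Change of variables to normal coordinates -/

theorem det_sum_proj_smulRight (v₀ v₁ v₂ : E3) :
    ((PiLp.proj 2 (fun _ : Fin 3 => ℝ) 0 : E3 →L[ℝ] ℝ).smulRight v₀ +
      (PiLp.proj 2 (fun _ : Fin 3 => ℝ) 1 : E3 →L[ℝ] ℝ).smulRight v₁ +
      (PiLp.proj 2 (fun _ : Fin 3 => ℝ) 2 : E3 →L[ℝ] ℝ).smulRight v₂).det =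
    !![v₀ 0, v₁ 0, v₂ 0; v₀ 1, v₁ 1, v₂ 1; v₀ 2, v₁ 2, v₂ 2].det := by
  rw [ContinuousLinearMap.det,
    ← LinearMap.det_toMatrix (EuclideanSpace.basisFun (Fin 3) ℝ).toBasis]
  congr 1
  ext i j
  rw [LinearMap.toMatrix_apply]
  fin_cases i <;> fin_cases j <;> simp

theorem curvature_eq {a b : ℝ} (hb : 0 < b) : curvature a b = a * freq a b ^ 2 := by
  have h := freq_sq_mul (a := a) hb
  have : a ^ 2 + b ^ 2 ≠ 0 := by positivity
  rw [curvature, div_eq_iff this]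
  linear_combination -a * h

/-- The normal coordinate map as a map of three-space to itself. -/
noncomputable def normalCoord (a b : ℝ) (y : E3) : E3 := normalMap a b (y 0) (y 1, y 2)

/-- The derivative of the normal coordinate map. -/
noncomputable def normalCoordDeriv (a b : ℝ) (y : E3) : E3 →L[ℝ] E3 :=
  (PiLp.proj 2 (fun _ : Fin 3 => ℝ) 0 : E3 →L[ℝ] ℝ).smulRight
      !₂[-((a - y 1) * freq a b * Real.sin (freq a b * y 0)) +
          y 2 * (b * freq a b ^ 2) * Real.cos (freq a b * y 0),
        (a - y 1) * freq a b * Real.cos (freq a b * y 0) +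
          y 2 * (b * freq a b ^ 2) * Real.sin (freq a b * y 0),
        b * freq a b] +
    (PiLp.proj 2 (fun _ : Fin 3 => ℝ) 1 : E3 →L[ℝ] ℝ).smulRight (helixN a b (y 0)) +
    (PiLp.proj 2 (fun _ : Fin 3 => ℝ) 2 : E3 →L[ℝ] ℝ).smulRight (helixB a b (y 0))

theorem hasFDerivAt_normalCoord (a b : ℝ) (y : E3) :
    HasFDerivAt (normalCoord a b) (normalCoordDeriv a b y) y := by
  have hp : ∀ i : Fin 3, HasFDerivAt (fun y : E3 => y i)
      (PiLp.proj 2 (fun _ : Fin 3 => ℝ) i : E3 →L[ℝ] ℝ) y := fun i =>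
    (PiLp.proj 2 (fun _ : Fin 3 => ℝ) i : E3 →L[ℝ] ℝ).hasFDerivAt
  have hk := (hp 0).const_mul (freq a b)
  rw [← hasFDerivWithinAt_univ, hasFDerivWithinAt_euclidean]
  intro i
  rw [hasFDerivWithinAt_univ]
  fin_cases i
  · refine HasFDerivAt.congr_fderiv (HasFDerivAt.congr_of_eventuallyEq
      ((((hp 1).const_sub a).mul hk.cos).add (((hp 2).const_mul (b * freq a b)).mul hk.sin))
      (Eventually.of_forall fun y => normalMap_apply_zero a b (y 0) (y 1, y 2))) ?_
    ext v
    simp [normalCoordDeriv, helixN, helixB]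
    ring
  · refine HasFDerivAt.congr_fderiv (HasFDerivAt.congr_of_eventuallyEq
      ((((hp 1).const_sub a).mul hk.sin).sub (((hp 2).const_mul (b * freq a b)).mul hk.cos))
      (Eventually.of_forall fun y => normalMap_apply_one a b (y 0) (y 1, y 2))) ?_
    ext v
    simp [normalCoordDeriv, helixN, helixB]
    ring
  · refine HasFDerivAt.congr_fderiv (HasFDerivAt.congr_of_eventuallyEq
      (((hp 0).const_mul (b * freq a b)).add ((hp 2).const_mul (a * freq a b)))
      (Eventually.of_forall fun y => normalMap_apply_two a b (y 0) (y 1, y 2))) ?_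
    ext v
    simp [normalCoordDeriv, helixN, helixB]
    ring

/-- By the Frenet equations the `s`-derivative of `ν` is `(1 - κ u₁) T` plus a combination of `N`
and `B`, and `(T, N, B)` is a positive orthonormal frame. -/
theorem det_normalCoordDeriv {a b : ℝ} (hb : 0 < b) (y : E3) :
    (normalCoordDeriv a b y).det = jacobian a b (y 1, y 2) := by
  have hk := freq_sq_mul (a := a) hb
  have htrig := Real.sin_sq_add_cos_sq (freq a b * y 0)
  rw [normalCoordDeriv, det_sum_proj_smulRight, Matrix.det_fin_three, jacobian, curvature_eq hb]
  simp [helixN, helixB]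
  linear_combination (a * freq a b ^ 2 * (a - y 1) + b ^ 2 * freq a b ^ 2) * htrig + hk

/-- Three-space as a product of the parameter line and the plane of normal coordinates. -/
noncomputable def splitCoord : E3 ≃ᵐ ℝ × (ℝ × ℝ) :=
  ((MeasurableEquiv.toLp 2 (Fin 3 → ℝ)).symm.trans
    (MeasurableEquiv.piFinSuccAbove (fun _ : Fin 3 => ℝ) 0)).trans
      (MeasurableEquiv.prodCongr (MeasurableEquiv.refl ℝ) MeasurableEquiv.finTwoArrow)

theorem splitCoord_apply (y : E3) : splitCoord y = (y 0, (y 1, y 2)) := rfl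

theorem measurePreserving_splitCoord : MeasurePreserving splitCoord volume volume :=
  ((MeasurePreserving.id volume).prod (volume_preserving_finTwoArrow ℝ)).comp
    ((volume_preserving_piFinSuccAbove (fun _ : Fin 3 => ℝ) 0).comp
      (EuclideanSpace.volume_preserving_symm_measurableEquiv_toLp (Fin 3)))

/-- Since the ellipse does not depend on `s`, the part of the cylinder projecting into `I` is the
image of a genuine product, ready for Fubini. -/
theorem preimage_projIndex_inter_solidCylinder {a b r : ℝ} (ha : 0 ≤ a) (hb : 0 < b) (hr : 0 < r)
    (h : a * r ≤ b ^ 2) (I : Set ℝ) :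
    projIndex (helix a b) ⁻¹' I ∩ solidCylinder r =
      normalCoord a b '' (splitCoord ⁻¹' (I ×ˢ solidEllipse a (b * freq a b) r)) := by
  ext x
  constructor
  · rintro ⟨hxI, hx⟩
    obtain ⟨s, hs⟩ := nonempty_nearestParams (continuous_helix a b) (tendsto_helix_cocompact hb) x
    have hslope := angularSlope_eq_zero_of_mem_nearestParams hb hs
    obtain ⟨u, rfl⟩ := exists_normalMap_eq hb hslope
    have hproj := projIndex_eq_of_angularSlope ha hb hr h hx hslope
    rw [Set.mem_preimage, hproj] at hxI
    refine ⟨!₂[s, u.1, u.2], ⟨hxI, ?_⟩, rfl⟩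
    rw [← crossSection_eq_solidEllipse a b r s]
    exact hx
  · rintro ⟨y, ⟨hyI, hyE⟩, rfl⟩
    rw [← crossSection_eq_solidEllipse a b r (y 0)] at hyE
    refine ⟨?_, hyE⟩
    have hproj : projIndex (helix a b) (normalCoord a b y) = y 0 :=
      projIndex_normalMap ha hb hr h hyE
    rw [Set.mem_preimage, hproj]
    exact hyI

/-- The image point determines `s` as its projection index, and then `u` within that normal plane.
-/
theorem injOn_normalCoord {a b r : ℝ} (ha : 0 ≤ a) (hb : 0 < b) (hr : 0 < r)
    (h : a * r ≤ b ^ 2) (I : Set ℝ) :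
    Set.InjOn (normalCoord a b) (splitCoord ⁻¹' (I ×ˢ solidEllipse a (b * freq a b) r)) := by
  rintro y ⟨-, hy⟩ z ⟨-, hz⟩ hyz
  rw [← crossSection_eq_solidEllipse a b r (y 0)] at hy
  rw [← crossSection_eq_solidEllipse a b r (z 0)] at hz
  have h0 : y 0 = z 0 := by
    have hy' := projIndex_normalMap ha hb hr h hy
    have hz' := projIndex_normalMap ha hb hr h hz
    have hyz' : normalMap a b (y 0) (y 1, y 2) = normalMap a b (z 0) (z 1, z 2) := hyz
    rw [← hy', ← hz']
    exact congrArg _ hyz'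
  apply splitCoord.injective
  rw [splitCoord_apply, splitCoord_apply, h0]
  congr 1
  apply normalMap_injective hb (z 0)
  have hyz' : normalMap a b (y 0) (y 1, y 2) = normalMap a b (z 0) (z 1, z 2) := hyz
  rwa [h0] at hyz'

theorem continuous_normalMap_uncurry (a b : ℝ) :
    Continuous fun p : ℝ × (ℝ × ℝ) => normalMap a b p.1 p.2 := by
  refine (PiLp.continuous_toLp 2 (fun _ : Fin 3 => ℝ)).comp
    (continuous_pi fun i => (?_ : Continuous fun p : ℝ × (ℝ × ℝ) => normalMap a b p.1 p.2 i))
  fin_cases i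
  · simp only [Fin.zero_eta, normalMap_apply_zero]; fun_prop
  · simp only [Fin.mk_one, normalMap_apply_one]; fun_prop
  · simp only [Fin.reduceFinMk, normalMap_apply_two]; fun_prop

theorem isBounded_preimage_projIndex_inter_solidCylinder {a b r : ℝ} (ha : 0 ≤ a) (hb : 0 < b)
    (hr : 0 < r) (h : a * r ≤ b ^ 2) {I : Set ℝ} (hI : Bornology.IsBounded I) :
    Bornology.IsBounded (projIndex (helix a b) ⁻¹' I ∩ solidCylinder r) := by
  have hc : 0 < b * freq a b := mul_pos hb (freq_pos hb)
  refine ((hI.isCompact_closure.prod (isCompact_solidEllipse a hc hr)).image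
    (continuous_normalMap_uncurry a b)).isBounded.subset ?_
  rw [preimage_projIndex_inter_solidCylinder ha hb hr h]
  rintro _ ⟨y, ⟨hyI, hyE⟩, rfl⟩
  exact ⟨splitCoord y, ⟨subset_closure hyI, hyE⟩, rfl⟩

theorem setIntegral_sub_helix_projIndex {a b r : ℝ} (ha : 0 ≤ a) (hb : 0 < b) (hr : 0 < r)
    (h : a * r ≤ b ^ 2) (hmean : ∀ s, weightedMean a b s (crossSection a b r s) = helix a b s)
    {I : Set ℝ} (hIm : MeasurableSet I) (hI : Bornology.IsBounded I) :
    ∫ x in projIndex (helix a b) ⁻¹' I ∩ solidCylinder r,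
      (x - helix a b (projIndex (helix a b) x)) = 0 := by
  have hc : 0 < b * freq a b := mul_pos hb (freq_pos hb)
  set E := solidEllipse a (b * freq a b) r with hEdef
  have hEm : MeasurableSet E := measurableSet_solidEllipse a hc hr
  have hS : MeasurableSet (splitCoord ⁻¹' (I ×ˢ E)) := splitCoord.measurable (hIm.prod hEm)
  have hcont : Continuous fun p : ℝ × (ℝ × ℝ) =>
      jacobian a b p.2 • (normalMap a b p.1 p.2 - helix a b p.1) :=
    ((continuous_jacobian a b).comp continuous_snd).smul
      ((continuous_normalMap_uncurry a b).sub ((continuous_helix a b).comp continuous_fst))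
  rw [preimage_projIndex_inter_solidCylinder ha hb hr h,
    integral_image_eq_integral_abs_det_fderiv_smul volume hS
      (fun y _ => (hasFDerivAt_normalCoord a b y).hasFDerivWithinAt) (injOn_normalCoord ha hb hr h I)]
  have hcongr : Set.EqOn
      (fun y => |(normalCoordDeriv a b y).det| •
        (normalCoord a b y - helix a b (projIndex (helix a b) (normalCoord a b y))))
      (fun y => (fun p : ℝ × (ℝ × ℝ) =>
        jacobian a b p.2 • (normalMap a b p.1 p.2 - helix a b p.1)) (splitCoord y))
      (splitCoord ⁻¹' (I ×ˢ E)) := by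
    -- The Jacobian constraint removes the absolute value from the determinant, leaving the weight
    -- of the mean.
    rintro y ⟨-, hy⟩
    rw [hEdef, ← crossSection_eq_solidEllipse a b r (y 0)] at hy
    have hJ : 0 ≤ jacobian a b (y 1, y 2) := (jacobianConstraint_iff ha hb hr).2 h _ _ hy
    have hproj := projIndex_normalMap ha hb hr h hy
    simp only [det_normalCoordDeriv hb, abs_of_nonneg hJ, splitCoord_apply, normalCoord]
    rw [show projIndex (helix a b) (normalMap a b (y 0) (y 1, y 2)) = y 0 from hproj]
  rw [setIntegral_congr_fun hS hcongr,
    measurePreserving_splitCoord.setIntegral_preimage_emb splitCoord.measurableEmbedding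
      (fun p : ℝ × (ℝ × ℝ) => jacobian a b p.2 • (normalMap a b p.1 p.2 - helix a b p.1)),
    Measure.volume_eq_prod, setIntegral_prod]
  -- For fixed `s`, `hmean` multiplied by the weighted area says that the inner integral is zero.
  · refine integral_eq_zero_of_ae (Eventually.of_forall fun s => ?_)
    have hA := (weightedArea_crossSection_pos (a := a) hb hr s).ne'
    have hm := hmean s
    rw [weightedMean, inv_smul_eq_iff₀ hA, crossSection_eq_solidEllipse] at hm
    simp only [smul_sub, Pi.zero_apply]
    rw [integral_sub, hm, integral_smul_const, weightedArea, sub_self]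
    · exact integrableOn_solidEllipse a hc hr
        ((continuous_jacobian a b).smul (continuous_normalMap a b s))
    · exact integrableOn_solidEllipse a hc hr ((continuous_jacobian a b).smul continuous_const)
  · rw [← Measure.volume_eq_prod]
    exact (hcont.continuousOn.integrableOn_compact
      (hI.isCompact_closure.prod (isCompact_solidEllipse a hc hr))).mono_set
        (Set.prod_mono subset_closure subset_rfl)

/-! ### Self-consistency and the main theorem -/

theorem measurableSet_solidCylinder (r : ℝ) : MeasurableSet (solidCylinder r) := by
  have : IsClosed (solidCylinder r) := isClosed_le (by fun_prop) continuous_const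
  exact this.measurableSet

theorem isSelfConsistent_helix {a b r : ℝ} (ha : 0 ≤ a) (hb : 0 < b) (hr : 0 < r)
    (h : a * r ≤ b ^ 2) (hmean : ∀ s, weightedMean a b s (crossSection a b r s) = helix a b s) :
    IsSelfConsistent (cylinderMeasure r) (helix a b) := by
  have hcont := continuous_helix a b
  have hmeas : Measurable (projIndex (helix a b)) :=
    measurable_projIndex hcont (tendsto_helix_cocompact hb)
  have hrestrict : ∀ I : Set ℝ, MeasurableSet I →
      (cylinderMeasure r).restrict (projIndex (helix a b) ⁻¹' I) =
        volume.restrict (projIndex (helix a b) ⁻¹' I ∩ solidCylinder r) := fun I hI =>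
    Measure.restrict_restrict (hmeas hI)
  have hset : ∀ I : Set ℝ, MeasurableSet I →
      MeasurableSet (projIndex (helix a b) ⁻¹' I ∩ solidCylinder r) := fun I hI =>
    (hmeas hI).inter (measurableSet_solidCylinder r)
  have hleft : ∀ I : Set ℝ, MeasurableSet I → Bornology.IsBounded I →
      IntegrableOn (fun x => x) (projIndex (helix a b) ⁻¹' I) (cylinderMeasure r) := by
    intro I hIm hI
    have hB := isBounded_preimage_projIndex_inter_solidCylinder ha hb hr h hI
    rw [IntegrableOn, hrestrict I hIm]
    exact (continuous_id.continuousOn.integrableOn_compact hB.isCompact_closure).mono_set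
      subset_closure
  have hright : ∀ I : Set ℝ, MeasurableSet I → Bornology.IsBounded I →
      IntegrableOn (fun x => helix a b (projIndex (helix a b) x)) (projIndex (helix a b) ⁻¹' I)
        (cylinderMeasure r) := by
    intro I hIm hI
    have hB := isBounded_preimage_projIndex_inter_solidCylinder ha hb hr h hI
    obtain ⟨M, hM⟩ := (hI.isCompact_closure.image hcont).isBounded.exists_norm_le
    rw [IntegrableOn, hrestrict I hIm]
    refine Measure.integrableOn_of_bounded (M := M) hB.measure_lt_top.ne
      (hcont.measurable.comp hmeas).aestronglyMeasurable ?_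
    refine (ae_restrict_mem (hset I hIm)).mono fun x hx => ?_
    exact hM _ ⟨_, subset_closure hx.1, rfl⟩
  refine ⟨hmeas, hcont.measurable, hleft, hright, fun I hIm hI => ?_⟩
  rw [← sub_eq_zero, ← integral_sub (hleft I hIm hI) (hright I hIm hI), hrestrict I hIm]
  exact setIntegral_sub_helix_projIndex ha hb hr h hmean hIm hI

theorem isPrincipalCurve_helix {a b r : ℝ} (ha : 0 ≤ a) (hb : 0 < b) (hr : 0 < r)
    (h : a * r ≤ b ^ 2) (hmean : ∀ s, weightedMean a b s (crossSection a b r s) = helix a b s) :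
    IsPrincipalCurve (cylinderMeasure r) (helix a b) where
  smooth := contDiff_helix a b
  unit_speed := norm_deriv_helix hb
  injective := helix_injective hb
  proper := tendsto_helix_cocompact hb
  selfConsistent := isSelfConsistent_helix ha hb hr h hmean

end PrincipalHelix

theorem mainTheorem6 (a b r : ℝ) (ha : 0 ≤ a) (hb : 0 < b) (hr : 0 < r) :
    -- the weighted mean of every normal cross-section
    (∀ s : ℝ,
      crossSection a b r s = {u | (a - u.1) ^ 2 + (b * freq a b * u.2) ^ 2 ≤ r ^ 2} ∧
      IntegrableOn (jacobian a b) (crossSection a b r s) ∧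
      0 < weightedArea a b (crossSection a b r s) ∧
      IntegrableOn (fun u => jacobian a b u • normalMap a b s u) (crossSection a b r s) ∧
      weightedMean a b s (crossSection a b r s) =
        !₂[a * r ^ 2 / (4 * b ^ 2) * Real.cos (freq a b * s),
          a * r ^ 2 / (4 * b ^ 2) * Real.sin (freq a b * s), b * freq a b * s]) ∧
    weightedMean a b 0 (crossSection a b r 0) = !₂[a * r ^ 2 / (4 * b ^ 2), 0, 0] ∧
    -- under the Jacobian constraint the cross-sections are the fibres of the projection
    (JacobianConstraint a b r →
      Disjoint (solidCylinder r) (ambiguityPoints (helix a b)) ∧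
      ∀ s : ℝ, fibre a b r s = crossSection a b r s) ∧
    -- the parameters for which the mean lies on the helix and the constraint holds
    (0 < a →
      (((∀ s : ℝ, weightedMean a b s (crossSection a b r s) = helix a b s) ∧
        JacobianConstraint a b r) ↔ (b = r / 2 ∧ a ≤ r / 4))) ∧
    -- for these parameters the helix is a principal curve
    (b = r / 2 → a ≤ r / 4 →
      JacobianConstraint a b r ∧
      (∀ s : ℝ, weightedMean a b s (fibre a b r s) = helix a b s) ∧
      IsPrincipalCurve (cylinderMeasure r) (helix a b)) := by
  have hc : 0 < b * freq a b := mul_pos hb (freq_pos hb)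
  have hcon := jacobianConstraint_iff ha hb hr
  have hpitch : b = r / 2 → (a * r ≤ b ^ 2 ↔ a ≤ r / 4) := by
    rintro rfl
    rw [show (r / 2) ^ 2 = r / 4 * r by ring, mul_le_mul_iff_left₀ hr]
  refine ⟨fun s => ⟨crossSection_eq a b r s, ?_, weightedArea_crossSection_pos hb hr s, ?_,
    weightedMean_crossSection hb hr s⟩, ?_, fun h => ?_, fun ha' => ⟨?_, ?_⟩, fun hbr har => ?_⟩
  · rw [crossSection_eq_solidEllipse]
    exact integrableOn_solidEllipse a hc hr (continuous_jacobian a b)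
  · rw [crossSection_eq_solidEllipse]
    exact integrableOn_solidEllipse a hc hr
      ((continuous_jacobian a b).smul (continuous_normalMap a b s))
  · rw [weightedMean_crossSection hb hr]
    simp
  · exact ⟨disjoint_ambiguityPoints ha hb hr (hcon.1 h),
      fibre_eq_crossSection ha hb hr (hcon.1 h)⟩
  · rintro ⟨hmean, hJ⟩
    -- The first coordinate at `s = 0` already gives `a r² = 4 a b²`. Cancelling `a` is where `0 <
    -- a` enters: for `a = 0` the mean lies on the helix for every `b`.
    have h0 := congrArg (fun x : E3 => x 0) ((weightedMean_crossSection hb hr 0).symm.trans (hmean 0))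
    simp only [helix, mul_zero, Real.cos_zero, mul_one, PiLp.toLp_apply, Matrix.cons_val_zero] at h0
    rw [div_eq_iff (by positivity)] at h0
    have hsq : r ^ 2 = (2 * b) ^ 2 := by
      refine mul_left_cancel₀ ha'.ne' ?_
      linear_combination h0
    have hb2 : b = r / 2 := by
      have := (pow_left_inj₀ hr.le (by positivity) two_ne_zero).1 hsq
      linarith
    exact ⟨hb2, (hpitch hb2).1 (hcon.1 hJ)⟩
  · rintro ⟨hb2, har⟩
    exact ⟨weightedMean_crossSection_eq_helix hb hr hb2, hcon.2 ((hpitch hb2).2 har)⟩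
  · have h := (hpitch hbr).2 har
    have hmean := weightedMean_crossSection_eq_helix (a := a) hb hr hbr
    refine ⟨hcon.2 h, fun s => ?_, isPrincipalCurve_helix ha hb hr h hmean⟩
    rw [fibre_eq_crossSection ha hb hr h, hmean]
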